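/- Let $n\ge 1$ be an integer and let $p,q\in[1,\infty]$ be conjugate exponents, $1/p+1/q=1$ with $1/\infty=0$. Let $\mathcal P_n$ be the set of monic real polynomials of degree $n$. For $a<b$ let $\|\cdot\|_p$ denote the norm of $L^p([a,b])$, and let $W_{a,b}$ be the set of functions $f:[a,b]\to\mathbb R$ such that $f^{(n-1)}$ exists and is absolutely continuous on $[a,b]$ and $f^{(n)}\in L^p([a,b])$. For $\phi\in\mathcal P_n$ and $f\in W_{a,b}$ put $$E_n(f)=E_n^{\phi}(f)=\frac{(-1)^n}{n!}\int_a^b f^{(n)}(x)\,\phi(x)\,dx .$$ (1) For all $a<b$, $f\in W_{a,b}$ and $\phi\in\mathcal P_n$ the integrals exist, $$\int_a^b f(x)\,dx=\frac{(-1)^n}{n!}\sum_{k=0}^{n-1}(-1)^{n-k-1}\left[\phi^{(n-k-1)}(a)f^{(k)}(a)-\phi^{(n-k-1)}(b)f^{(k)}(b)\right]+E_n(f),$$ and $|E_n(f)|\le \|f^{(n)}\|_p\|\phi\|_q/n!$. (2) For $a<b$, each $\phi\in\mathcal P_n$ can be written as $\phi=\psi_{a,b}$ for exactly one $\psi\in\mathcal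 P_n$, where $$\psi_{a,b}(x)=\left(\frac{b-a}{2}\right)^{n}\psi\!\left(\frac{2x-a-b}{b-a}\right),$$ and conversely $\psi_{a,b}\in\mathcal P_n$ for every $\psi\in\mathcal P_n$. For each $\psi\in\mathcal P_n$ there is a least constant $K_{n,p}=K_{n,p}(\psi)$, depending only on $n$, $p$ and $\psi$, such that for all $a<b$ and all $f\in W_{a,b}$, with $\phi=\psi_{a,b}$, $$\frac{\|f^{(n)}\|_p\|\phi\|_q}{n!}\le K_{n,p}(\psi)\,\|f^{(n)}\|_p\,(b-a)^{n+1/q}.$$ (3) There is a unique $\tilde\phi_n\in\mathcal P_n$ that minimizes $K_{n,p}(\psi)$ over $\psi\in\mathcal P_n$. The minimum is $$\tilde K_{n,p}=K_{n,p}(\tilde\phi_n)=\frac{2^{-n-1/q}\,\|\tilde\phi_n\|_q}{n!},$$ with the norm of $\tilde\phi_n$ taken over $[-1,1]$. (4) The resulting estimate is sharp: for all $a<b$, with $\phi=(\tilde\phi_n)_{a,b}$, the number $\tilde K_{n,p}(b-a)^{n+1/q}$ is the least real $c$ such that $|E_n(f)|\le c\,\|f^{(n)}\|_p$ for all $f\in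 W_{a,b}$. -/

import Mathlib

open MeasureTheory Polynomial
open scoped ENNReal

noncomputable section

namespace CorrectedTrapezoid

/-- The `L^p` norm of `g` over `[a, b]` with respect to Lebesgue measure. -/
def normOn (g : ℝ → ℝ) (p : ℝ≥0∞) (a b : ℝ) : ℝ :=
  lpNorm g p (volume.restrict (Set.Icc a b))

/-- The `k`-th derivative of `f` as a function on `[a, b]` (one-sided at the endpoints). -/
def derivOn (k : ℕ) (f : ℝ → ℝ) (a b : ℝ) : ℝ → ℝ :=
  iteratedDerivWithin k f (Set.Icc a b)

/-- The functions `f` on `[a, b]` whose derivative of order `n - 1` exists and is absolutely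
continuous, and whose derivative of order `n` is in `L^p([a, b])`. It is used for `1 ≤ n`. -/
structure IsRegular (n : ℕ) (p : ℝ≥0∞) (a b : ℝ) (f : ℝ → ℝ) : Prop where
  contDiffOn : ContDiffOn ℝ ((n - 1 : ℕ) : WithTop ℕ∞) f (Set.Icc a b)
  absolutelyContinuous : AbsolutelyContinuousOnInterval (derivOn (n - 1) f a b) a b
  memLp : MemLp (derivOn n f a b) p (volume.restrict (Set.Icc a b))

/-- The monic real polynomials of degree `n`. -/
def monicPolys (n : ℕ) : Set ℝ[X] := {φ | φ.Monic ∧ φ.natDegree = n}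

/-- The boundary terms of the corrected trapezoidal rule built on `φ`. -/
def quadrature (n : ℕ) (φ : ℝ[X]) (f : ℝ → ℝ) (a b : ℝ) : ℝ :=
  (-1) ^ n / (n.factorial : ℝ) * ∑ k ∈ Finset.range n, (-1) ^ (n - k - 1) *
    ((derivative^[n - k - 1] φ).eval a * derivOn k f a b a -
      (derivative^[n - k - 1] φ).eval b * derivOn k f a b b)

/-- The error term `E_n(f)`. -/
def errorTerm (n : ℕ) (φ : ℝ[X]) (f : ℝ → ℝ) (a b : ℝ) : ℝ :=
  (-1) ^ n / (n.factorial : ℝ) * ∫ x in a..b, derivOn n f a b x * φ.eval x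

/-- The polynomial `x ↦ ((b - a) / 2) ^ n * ψ ((2 x - a - b) / (b - a))`, that is, `ψ` carried
from `[-1, 1]` to `[a, b]` with its leading coefficient kept. -/
def transplant (n : ℕ) (a b : ℝ) (ψ : ℝ[X]) : ℝ[X] :=
  C (((b - a) / 2) ^ n) * ψ.comp (C (2 / (b - a)) * X - C ((a + b) / (b - a)))

/-- The constants `K` that, for the polynomials coming from `ψ`, serve in the estimate
`‖f^(n)‖_p ‖φ‖_q / n! ≤ K ‖f^(n)‖_p (b - a) ^ (n + 1/q)` for all intervals and all `f`. -/
def admissibleConstants (n : ℕ) (p q : ℝ≥0∞) (ψ : ℝ[X]) : Set ℝ :=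
  {K | ∀ a b : ℝ, a < b → ∀ f : ℝ → ℝ, IsRegular n p a b f →
    normOn (derivOn n f a b) p a b * normOn (fun x => (transplant n a b ψ).eval x) q a b /
        (n.factorial : ℝ) ≤
      K * normOn (derivOn n f a b) p a b * (b - a) ^ ((n : ℝ) + (q⁻¹).toReal)}

/-- The constant `K_{n,p}` that belongs to `ψ`: the best admissible one. -/
def errorConst (n : ℕ) (p q : ℝ≥0∞) (ψ : ℝ[X]) : ℝ :=
  sInf (admissibleConstants n p q ψ)

/-- `ψ` minimizes `K_{n,p}` over the monic polynomials of degree `n`. -/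
def IsMinimizer (n : ℕ) (p q : ℝ≥0∞) (ψ : ℝ[X]) : Prop :=
  ψ ∈ monicPolys n ∧ ∀ χ ∈ monicPolys n, errorConst n p q ψ ≤ errorConst n p q χ

end CorrectedTrapezoid

end

/-! Since `φ` is monic of degree `n`, its `n`-th derivative is `n!`, and `n` integrations by parts
move the derivatives from `φ` to `f` (`integral_eq_sum_boundary`). Hölder's inequality bounds the
remaining integral.

Transplanting to an interval of length `b - a` multiplies the `L^q` norm by `((b - a) / 2) ^ (n +
1/q)` (`normOn_transplant`). Hence `K_{n,p}(ψ)` is a fixed multiple of the norm of `ψ` on `[-1, 1]`,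
and the task is to find the monic polynomial of least `L^q` norm.

A minimizer exists because this is best approximation of `X ^ n` from a finite-dimensional space
(`exists_normOn_le`). It is unique (`eq_of_normOn_le`): for `q = ∞` by the extremality of Chebyshev
polynomials, for `1 < q < ∞` by strict convexity, and for `q = 1` because the midpoint of two
minimizers has `n` distinct zeros, at which both must vanish.

Sharpness is the converse of Hölder's inequality (`normOn_le_of_forall_abs_integral_le`). Continuous
test functions suffice for it, and each of them is the `n`-th derivative of some regular `f`. -/

noncomputable section

namespace CorrectedTrapezoid

/-! ### Affine change of variable on monic polynomials -/

section Transplant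

/-- The substitution divides the leading coefficient by `h ^ n`, and the outer factor restores it.
The scale `h = (b - a) / 2` gives `transplant`, and `h = 2 / (b - a)` its inverse. -/
lemma affine_comp_mem_monicPolys {n : ℕ} {h : ℝ} (hh : h ≠ 0) (d : ℝ) {φ : ℝ[X]}
    (hφ : φ ∈ monicPolys n) :
    C (h ^ n) * φ.comp (C h⁻¹ * X + C d) ∈ monicPolys n := by
  obtain ⟨hm, hd⟩ := hφ
  have hlin : (C h⁻¹ * X + C d : ℝ[X]).natDegree = 1 := natDegree_linear (inv_ne_zero hh)
  have hlc : (C h⁻¹ * X + C d : ℝ[X]).leadingCoeff = h⁻¹ := leadingCoeff_linear (inv_ne_zero hh)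
  constructor
  · rw [Monic, leadingCoeff_mul, leadingCoeff_C, leadingCoeff_comp (by rw [hlin]; simp), hlc,
      hm.leadingCoeff, hd, one_mul, ← mul_pow, mul_inv_cancel₀ hh, one_pow]
  · rw [natDegree_C_mul (pow_ne_zero _ hh), natDegree_comp, hlin, hd, mul_one]

lemma transplant_mem_monicPolys {n : ℕ} {a b : ℝ} (hab : a < b) {ψ : ℝ[X]}
    (hψ : ψ ∈ monicPolys n) : transplant n a b ψ ∈ monicPolys n := by
  have h : (b - a) / 2 ≠ 0 := by linarith
  have := affine_comp_mem_monicPolys h (-((a + b) / (b - a))) hψ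
  rwa [inv_div, C_neg, ← sub_eq_add_neg] at this

lemma eval_transplant (n : ℕ) (a b : ℝ) (ψ : ℝ[X]) (x : ℝ) :
    (transplant n a b ψ).eval x =
      ((b - a) / 2) ^ n * ψ.eval (2 / (b - a) * x - (a + b) / (b - a)) := by
  simp [transplant]

lemma transplant_injective (n : ℕ) {a b : ℝ} (hab : a < b) :
    Function.Injective (transplant n a b) := by
  intro ψ χ h
  have hba : b - a ≠ 0 := by linarith
  refine Polynomial.funext fun y => ?_
  have := congrArg (eval ((b - a) / 2 * y + (a + b) / 2)) h
  rw [eval_transplant, eval_transplant] at this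
  have h2 := mul_left_cancel₀ (pow_ne_zero n (div_ne_zero hba two_ne_zero)) this
  have h3 : 2 / (b - a) * ((b - a) / 2 * y + (a + b) / 2) - (a + b) / (b - a) = y := by
    field_simp; ring
  rwa [h3] at h2

lemma exists_transplant_eq {n : ℕ} {a b : ℝ} (hab : a < b) {φ : ℝ[X]} (hφ : φ ∈ monicPolys n) :
    ∃ ψ ∈ monicPolys n, φ = transplant n a b ψ := by
  have hba : b - a ≠ 0 := by linarith
  refine ⟨_, affine_comp_mem_monicPolys (h := 2 / (b - a)) (by positivity) ((a + b) / 2) hφ, ?_⟩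
  refine Polynomial.funext fun x => ?_
  rw [eval_transplant]
  simp only [eval_mul, eval_C, eval_comp, eval_add, eval_X, inv_div]
  rw [← mul_assoc, ← mul_pow]
  have h1 : (b - a) / 2 * (2 / (b - a)) = 1 := by field_simp
  have h2 : (b - a) / 2 * (2 / (b - a) * x - (a + b) / (b - a)) + (a + b) / 2 = x := by
    field_simp; ring
  rw [h1, h2, one_pow, one_mul]

end Transplant

/-! ### Norms on an interval, scaling and Hölder's inequality -/

section Norms

lemma memLp_of_continuous {g : ℝ → ℝ} (hg : Continuous g) (p : ℝ≥0∞) (a b : ℝ) :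
    MemLp g p (volume.restrict (Set.Icc a b)) := by
  obtain ⟨M, hM⟩ := isCompact_Icc.exists_bound_of_continuousOn (hg.continuousOn (s := Set.Icc a b))
  refine MemLp.of_bound hg.aestronglyMeasurable M ?_
  exact (ae_restrict_iff' measurableSet_Icc).2 (Filter.Eventually.of_forall hM)

lemma normOn_congr {g h : ℝ → ℝ} {p : ℝ≥0∞} {a b : ℝ} (H : ∀ x ∈ Set.Icc a b, g x = h x) :
    normOn g p a b = normOn h p a b := by
  have hae : g =ᵐ[volume.restrict (Set.Icc a b)] h :=
    (ae_restrict_iff' measurableSet_Icc).2 (Filter.Eventually.of_forall H)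
  -- `lpNorm` takes the value 0 on functions that are not a.e. strongly measurable, so measurability
  -- has to be transferred as well.
  have hm : AEStronglyMeasurable g (volume.restrict (Set.Icc a b)) ↔
      AEStronglyMeasurable h (volume.restrict (Set.Icc a b)) := aestronglyMeasurable_congr hae
  rw [normOn, normOn, lpNorm, lpNorm, eLpNorm_congr_ae hae]
  split_ifs <;> tauto

lemma normOn_pos {p : ℝ≥0∞} (hp : p ≠ 0) {a b : ℝ} (hab : a < b) {g : ℝ → ℝ} (hg : Continuous g)
    {x : ℝ} (hx : x ∈ Set.Icc a b) (hgx : g x ≠ 0) : 0 < normOn g p a b := by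
  refine lt_of_le_of_ne lpNorm_nonneg (Ne.symm fun h0 => hgx ?_)
  rw [normOn, lpNorm_eq_zero (memLp_of_continuous hg p a b) hp] at h0
  exact Measure.eqOn_Icc_of_ae_eq volume hab.ne h0 hg.continuousOn continuousOn_const hx

lemma normOn_one_eq {g : ℝ → ℝ} (hg : Continuous g) {a b : ℝ} (hab : a ≤ b) :
    normOn g 1 a b = ∫ x in a..b, |g x| := by
  rw [normOn, lpNorm_one_eq_integral_norm hg.aestronglyMeasurable,
    intervalIntegral.integral_of_le hab, ← integral_Icc_eq_integral_Ioc]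
  rfl

lemma normOn_eq_rpow {g : ℝ → ℝ} (hg : Continuous g) {q : ℝ≥0∞} (hq : q ≠ 0) (hq' : q ≠ ∞)
    {a b : ℝ} (hab : a ≤ b) :
    normOn g q a b = (∫ x in a..b, |g x| ^ q.toReal) ^ q.toReal⁻¹ := by
  rw [normOn, lpNorm_eq_integral_norm_rpow_toReal hq hq' hg.aestronglyMeasurable,
    intervalIntegral.integral_of_le hab, ← integral_Icc_eq_integral_Ioc]
  rfl

lemma normOn_top_le {g : ℝ → ℝ} {a b M : ℝ} (hM : 0 ≤ M) (h : ∀ x ∈ Set.Icc a b, |g x| ≤ M) :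
    normOn g ∞ a b ≤ M := by
  have hae : ∀ᵐ x ∂(volume.restrict (Set.Icc a b)), ‖g x‖ ≤ M :=
    (ae_restrict_iff' measurableSet_Icc).2 (Filter.Eventually.of_forall h)
  rw [normOn, lpNorm]
  split_ifs
  · rw [eLpNorm_exponent_top]
    exact ENNReal.toReal_le_of_le_ofReal hM (eLpNormEssSup_le_of_ae_bound hae)
  · exact hM

lemma abs_le_normOn_top {g : ℝ → ℝ} (hg : Continuous g) {a b : ℝ} (hab : a < b) {x : ℝ}
    (hx : x ∈ Set.Icc a b) : |g x| ≤ normOn g ∞ a b := by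
  have h := ae_le_lpNorm_exponent_top (memLp_of_continuous hg ∞ a b)
  -- The excess of `|g|` over its essential supremum is continuous and a.e. zero, hence zero at
  -- every point.
  have hae : (fun x => max (|g x| - normOn g ∞ a b) 0) =ᵐ[volume.restrict (Set.Icc a b)]
      fun _ => 0 := by
    filter_upwards [h] with y hy
    exact max_eq_right (sub_nonpos.2 hy)
  have := Measure.eqOn_Icc_of_ae_eq volume hab.ne hae (by fun_prop) continuousOn_const hx
  exact sub_nonpos.1 (max_eq_right_iff.1 this)

/-- A nonnegative continuous function with nonpositive integral vanishes. -/
lemma eq_zero_of_integral_nonpos {g : ℝ → ℝ} (hg : Continuous g) {a b : ℝ} (hab : a < b)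
    (h0 : ∀ x, 0 ≤ g x) (hint : ∫ x in a..b, g x ≤ 0) {x : ℝ} (hx : x ∈ Set.Icc a b) :
    g x = 0 := by
  by_contra hne
  have h := normOn_pos one_ne_zero hab hg hx hne
  rw [normOn_one_eq hg hab.le] at h
  simp only [abs_of_nonneg (h0 _)] at h
  linarith

lemma map_affine_restrict_Icc {a b : ℝ} (hab : a < b) :
    Measure.map (fun x => 2 / (b - a) * x - (a + b) / (b - a)) (volume.restrict (Set.Icc a b)) =
      ENNReal.ofReal ((b - a) / 2) • volume.restrict (Set.Icc (-1) 1) := by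
  have hba : 0 < b - a := by linarith
  have hc : 2 / (b - a) ≠ 0 := by positivity
  have hm1 : Measurable (fun x : ℝ => 2 / (b - a) * x) := by fun_prop
  have hm2 : Measurable (fun x : ℝ => x - (a + b) / (b - a)) := by fun_prop
  have hmap : Measure.map (fun x : ℝ => 2 / (b - a) * x - (a + b) / (b - a)) volume =
      ENNReal.ofReal ((b - a) / 2) • volume := by
    have : (fun x : ℝ => 2 / (b - a) * x - (a + b) / (b - a)) =
      (fun x => x - (a + b) / (b - a)) ∘ fun x => 2 / (b - a) * x := rfl
    rw [this, ← Measure.map_map hm2 hm1, Real.map_volume_mul_left hc, Measure.map_smul,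
      map_sub_right_eq_self, inv_div, abs_of_pos (by positivity)]
  have hpre : Set.Icc a b =
      (fun x : ℝ => 2 / (b - a) * x - (a + b) / (b - a)) ⁻¹' Set.Icc (-1) 1 := by
    ext x
    have h : 2 / (b - a) * x - (a + b) / (b - a) = (2 * x - (a + b)) / (b - a) := by ring
    simp only [Set.mem_Icc, Set.mem_preimage, h]
    rw [le_div_iff₀ hba, div_le_iff₀ hba]
    constructor <;> rintro ⟨h1, h2⟩ <;> constructor <;> linarith
  have hm : Measurable (fun x : ℝ => 2 / (b - a) * x - (a + b) / (b - a)) := by fun_prop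
  rw [hpre, ← Measure.restrict_map hm measurableSet_Icc, hmap, Measure.restrict_smul]

/-- The exponent `n` comes from the normalizing factor of `transplant`, and `1/q` from the Jacobian
of the substitution; the latter contributes nothing when `q = ∞`. -/
lemma normOn_transplant (n : ℕ) (q : ℝ≥0∞) {a b : ℝ} (hab : a < b) (ψ : ℝ[X]) :
    normOn (fun x => (transplant n a b ψ).eval x) q a b =
      ((b - a) / 2) ^ ((n : ℝ) + (q⁻¹).toReal) * normOn (fun x => ψ.eval x) q (-1) 1 := by
  have hba : 0 < (b - a) / 2 := by linarith
  set T : ℝ → ℝ := fun x => 2 / (b - a) * x - (a + b) / (b - a) with hT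
  have hTc : Continuous T := by fun_prop
  have h1 : (fun x => (transplant n a b ψ).eval x) =
      (((b - a) / 2) ^ n) • ((fun x => ψ.eval x) ∘ T) := by
    funext x
    rw [eval_transplant]
    rfl
  have h2 : eLpNorm ((fun x => ψ.eval x) ∘ T) q (volume.restrict (Set.Icc a b)) =
      ENNReal.ofReal ((b - a) / 2) ^ (1 / q).toReal •
        eLpNorm (fun x => ψ.eval x) q (volume.restrict (Set.Icc (-1) 1)) := by
    rw [← eLpNorm_map_measure ψ.continuous.aestronglyMeasurable hTc.aemeasurable,
      map_affine_restrict_Icc hab, eLpNorm_smul_measure_of_ne_zero (by simpa using hab)]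
  rw [normOn, h1, lpNorm_const_smul, lpNorm,
    if_pos ((ψ.continuous.comp hTc).aestronglyMeasurable), h2, normOn, lpNorm,
    if_pos ψ.continuous.aestronglyMeasurable, Real.rpow_add hba, Real.rpow_natCast]
  rw [smul_eq_mul, ENNReal.toReal_mul, ← ENNReal.toReal_rpow, ENNReal.toReal_ofReal hba.le,
    one_div, mul_assoc]
  simp [abs_of_pos (show 0 < b - a by linarith)]

lemma abs_integral_mul_le {p q : ℝ≥0∞} (hpq : p.HolderConjugate q) {a b : ℝ} (hab : a ≤ b)
    {g h : ℝ → ℝ} (hg : MemLp g p (volume.restrict (Set.Icc a b)))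
    (hh : MemLp h q (volume.restrict (Set.Icc a b))) :
    |∫ x in a..b, g x * h x| ≤ normOn g p a b * normOn h q a b := by
  rw [intervalIntegral.integral_of_le hab, ← integral_Icc_eq_integral_Ioc]
  have h1 : eLpNorm (g • h) 1 (volume.restrict (Set.Icc a b)) ≤
      eLpNorm g p (volume.restrict (Set.Icc a b)) * eLpNorm h q (volume.restrict (Set.Icc a b)) :=
    eLpNorm_smul_le_mul_eLpNorm hh.1 hg.1
  have hfin := ENNReal.mul_ne_top hg.2.ne hh.2.ne
  have h2 := ENNReal.toReal_mono hfin h1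
  rw [ENNReal.toReal_mul] at h2
  rw [normOn, normOn, lpNorm, lpNorm, if_pos hg.1, if_pos hh.1]
  refine le_trans ?_ h2
  have h3 := lpNorm_one_eq_integral_norm (hg.1.smul hh.1)
  rw [lpNorm, if_pos (hg.1.smul hh.1)] at h3
  rw [h3]
  exact norm_integral_le_integral_norm (fun x => g x * h x)

lemma intervalIntegrable_mul {p q : ℝ≥0∞} (hpq : p.HolderConjugate q) {a b : ℝ} (hab : a ≤ b)
    {g h : ℝ → ℝ} (hg : MemLp g p (volume.restrict (Set.Icc a b)))
    (hh : MemLp h q (volume.restrict (Set.Icc a b))) :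
    IntervalIntegrable (fun x => g x * h x) volume a b := by
  rw [intervalIntegrable_iff_integrableOn_Icc_of_le hab]
  exact hg.integrable_mul hh

end Norms

/-! ### Regular functions and the quadrature formula -/

section Regular

lemma exists_iteratedDeriv_eq (n : ℕ) {g : ℝ → ℝ} (hg : Continuous g) :
    ∃ f : ℝ → ℝ, ContDiff ℝ n f ∧ iteratedDeriv n f = g := by
  induction n with
  | zero => exact ⟨g, contDiff_zero.2 hg, iteratedDeriv_zero⟩
  | succ n ih =>
    obtain ⟨F, hF, hFg⟩ := ih
    have hd : ∀ x, HasDerivAt (fun x => ∫ t in (0 : ℝ)..x, F t) (F x) x := fun x =>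
      intervalIntegral.integral_hasDerivAt_right (hF.continuous.intervalIntegrable _ _)
        hF.continuous.aestronglyMeasurable.stronglyMeasurableAtFilter hF.continuous.continuousAt
    have hd' : deriv (fun x => ∫ t in (0 : ℝ)..x, F t) = F := funext fun x => (hd x).deriv
    refine ⟨fun x => ∫ t in (0 : ℝ)..x, F t, ?_, ?_⟩
    · push_cast
      rw [contDiff_succ_iff_deriv]
      refine ⟨fun x => (hd x).differentiableAt, by simp, ?_⟩
      rwa [hd']
    · rw [iteratedDeriv_succ', hd', hFg]

lemma derivOn_eq_iteratedDeriv {n : ℕ} {f : ℝ → ℝ} (hf : ContDiff ℝ n f) {a b x : ℝ}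
    (hab : a < b) (hx : x ∈ Set.Icc a b) : derivOn n f a b x = iteratedDeriv n f x :=
  iteratedDerivWithin_eq_iteratedDeriv (uniqueDiffOn_Icc hab) hf.contDiffAt hx

lemma absolutelyContinuousOnInterval_derivOn {m k : ℕ} (hk : k < m) {f : ℝ → ℝ} {a b : ℝ}
    (hab : a < b) (hf : ContDiffOn ℝ m f (Set.Icc a b)) :
    AbsolutelyContinuousOnInterval (derivOn k f a b) a b := by
  refine ContDiffOn.absolutelyContinuousOnInterval ?_
  rw [Set.uIcc_of_le hab.le]
  have hf' : ContDiffOn ℝ (k + 1 : ℕ) f (Set.Icc a b) := hf.of_le (by exact_mod_cast hk)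
  exact ((contDiffOn_nat_succ_iff_contDiffOn_one_iteratedDerivWithin
    (uniqueDiffOn_Icc hab)).1 hf').2

/-- An `n`-fold antiderivative of `g` serves. This supplies the test functions for both leastness
claims. -/
lemma exists_isRegular {n : ℕ} (hn : 1 ≤ n) (p : ℝ≥0∞) {a b : ℝ} (hab : a < b) {g : ℝ → ℝ}
    (hg : Continuous g) :
    ∃ f : ℝ → ℝ, IsRegular n p a b f ∧ ∀ x ∈ Set.Icc a b, derivOn n f a b x = g x := by
  obtain ⟨f, hf, hfg⟩ := exists_iteratedDeriv_eq n hg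
  have heq : ∀ x ∈ Set.Icc a b, derivOn n f a b x = g x := fun x hx => by
    rw [derivOn_eq_iteratedDeriv hf hab hx, hfg]
  refine ⟨f, ⟨?_, ?_, ?_⟩, heq⟩
  · exact (hf.of_le (by norm_cast; omega)).contDiffOn
  · exact absolutelyContinuousOnInterval_derivOn (m := n) (by omega) hab hf.contDiffOn
  · refine (memLp_congr_ae ?_).2 (memLp_of_continuous hg p a b)
    exact (ae_restrict_iff' measurableSet_Icc).2 (Filter.Eventually.of_forall heq)

lemma IsRegular.absolutelyContinuous_derivOn {n k : ℕ} (hk : k < n) {p : ℝ≥0∞} {a b : ℝ}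
    (hab : a < b) {f : ℝ → ℝ} (hf : IsRegular n p a b f) :
    AbsolutelyContinuousOnInterval (derivOn k f a b) a b := by
  rcases (show k = n - 1 ∨ k < n - 1 by omega) with rfl | h
  · exact hf.absolutelyContinuous
  · exact absolutelyContinuousOnInterval_derivOn h hab hf.contDiffOn

lemma integral_mul_derivOn_succ {k : ℕ} {f : ℝ → ℝ} {a b : ℝ} (hab : a < b)
    (hf : AbsolutelyContinuousOnInterval (derivOn k f a b) a b) (χ : ℝ[X]) :
    ∫ x in a..b, χ.eval x * derivOn (k + 1) f a b x =
      χ.eval b * derivOn k f a b b - χ.eval a * derivOn k f a b a -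
        ∫ x in a..b, (derivative χ).eval x * derivOn k f a b x := by
  have hχ : AbsolutelyContinuousOnInterval (fun x => χ.eval x) a b :=
    ContDiffOn.absolutelyContinuousOnInterval (by
      simpa [coe_aeval_eq_eval] using (χ.contDiff_aeval (𝕜 := ℝ) 1).contDiffOn)
  have h := AbsolutelyContinuousOnInterval.integral_mul_deriv_eq_deriv_mul hχ hf
  simp only [Polynomial.deriv] at h
  rw [← h]
  refine intervalIntegral.integral_congr_ae_restrict ?_
  -- Dropping the endpoints, a null set, leaves interior points, where one-sided and ordinary
  -- derivatives agree.
  rw [Set.uIoc_of_le hab.le, ← restrict_Ioo_eq_restrict_Ioc]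
  refine (ae_restrict_iff' measurableSet_Ioo).2 (Filter.Eventually.of_forall fun x hx => ?_)
  simp only [derivOn]
  rw [iteratedDerivWithin_succ, derivWithin_of_mem_nhds (Icc_mem_nhds hx.1 hx.2)]

lemma integral_eq_sum_boundary {n : ℕ} {p : ℝ≥0∞} {a b : ℝ} (hab : a < b) {f : ℝ → ℝ}
    (hf : IsRegular n p a b f) (φ : ℝ[X]) {m : ℕ} (hm : m ≤ n) :
    ∫ x in a..b, (derivative^[n] φ).eval x * f x =
      ∑ k ∈ Finset.range m, (-1) ^ k *
        ((derivative^[n - k - 1] φ).eval b * derivOn k f a b b -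
          (derivative^[n - k - 1] φ).eval a * derivOn k f a b a) +
      (-1) ^ m * ∫ x in a..b, (derivative^[n - m] φ).eval x * derivOn m f a b x := by
  induction m with
  | zero => simp [derivOn]
  | succ m ih =>
    rw [ih (by omega), Finset.sum_range_succ, show n - (m + 1) = n - m - 1 by omega,
      integral_mul_derivOn_succ hab (hf.absolutelyContinuous_derivOn (by omega) hab),
      ← Function.iterate_succ_apply' (f := derivative),
      show (n - m - 1).succ = n - m by omega, pow_succ]
    ring

lemma integral_eq_quadrature_add_errorTerm {n : ℕ} {p : ℝ≥0∞} {a b : ℝ}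
    (hab : a < b) {f : ℝ → ℝ} (hf : IsRegular n p a b f) {φ : ℝ[X]} (hφ : φ ∈ monicPolys n) :
    ∫ x in a..b, f x = quadrature n φ f a b + errorTerm n φ f a b := by
  have hD : derivative^[n] φ = C (n.factorial : ℝ) := by
    obtain ⟨hm, hd⟩ := hφ
    have h0 : (derivative^[n] φ).natDegree = 0 := by
      have := natDegree_iterate_derivative φ n
      omega
    rw [eq_C_of_natDegree_eq_zero h0, coeff_iterate_derivative]
    have : φ.coeff n = 1 := by rw [← hd]; exact hm
    simp [this, Nat.descFactorial_self]
  have h := integral_eq_sum_boundary hab hf φ le_rfl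
  rw [hD] at h
  simp only [eval_C, intervalIntegral.integral_const_mul, tsub_self, Function.iterate_zero,
    id_eq] at h
  have hfac : (n.factorial : ℝ) ≠ 0 := by positivity
  rw [eq_comm, ← mul_right_inj' hfac, h, quadrature, errorTerm, mul_add, ← mul_assoc, ← mul_assoc,
    mul_div_cancel₀ _ hfac, Finset.mul_sum]
  congr 1
  · refine Finset.sum_congr rfl fun k hk => ?_
    have hk' : k < n := Finset.mem_range.1 hk
    -- The extra minus sign accounts for `quadrature` taking the value at `a` minus the value at
    -- `b`.
    have hs : (-1 : ℝ) ^ n * (-1) ^ (n - k - 1) = -(-1) ^ k := by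
      obtain ⟨j, rfl⟩ : ∃ j, n = k + j + 1 := ⟨n - k - 1, by omega⟩
      rw [show k + j + 1 - k - 1 = j by omega, pow_succ, pow_add]
      have : ((-1 : ℝ) ^ j) * (-1) ^ j = 1 := by rw [← mul_pow]; simp
      linear_combination (-(-1) ^ k) * this
    rw [← mul_assoc, hs]
    ring
  · simp only [mul_comm]

lemma IsRegular.intervalIntegrable {n : ℕ} {p : ℝ≥0∞} {a b : ℝ}
    (hab : a < b) {f : ℝ → ℝ} (hf : IsRegular n p a b f) : IntervalIntegrable f volume a b := by
  refine ContinuousOn.intervalIntegrable ?_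
  rw [Set.uIcc_of_le hab.le]
  exact hf.contDiffOn.continuousOn

lemma abs_errorTerm_le {n : ℕ} {p q : ℝ≥0∞} (hpq : p.HolderConjugate q) {a b : ℝ}
    (hab : a < b) {f : ℝ → ℝ} (hf : IsRegular n p a b f) (φ : ℝ[X]) :
    |errorTerm n φ f a b| ≤
      normOn (derivOn n f a b) p a b * normOn (fun x => φ.eval x) q a b / (n.factorial : ℝ) := by
  have h := abs_integral_mul_le hpq hab.le hf.memLp (memLp_of_continuous φ.continuous q a b)
  rw [errorTerm, abs_mul, abs_div, abs_pow, abs_neg, abs_one, one_pow, Nat.abs_cast, one_div,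
    div_eq_inv_mul]
  gcongr

end Regular

/-! ### The best constant as a multiple of a norm -/

section ErrorConst

/-- By scaling, this constant gives equality for every interval and every `f`. A single `f` with
nonzero `n`-th derivative therefore forces it; `f^(n) = 1` on `[0, 1]` is used. -/
lemma isLeast_admissibleConstants {n : ℕ} (hn : 1 ≤ n) {p q : ℝ≥0∞} (hp : p ≠ 0) (ψ : ℝ[X]) :
    IsLeast (admissibleConstants n p q ψ)
      ((2 : ℝ) ^ (-(n : ℝ) - (q⁻¹).toReal) * normOn (fun x => ψ.eval x) q (-1) 1 /
        (n.factorial : ℝ)) := by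
  have key : ∀ a b : ℝ, a < b → normOn (fun x => (transplant n a b ψ).eval x) q a b =
      (2 : ℝ) ^ (-(n : ℝ) - (q⁻¹).toReal) * normOn (fun x => ψ.eval x) q (-1) 1 *
        (b - a) ^ ((n : ℝ) + (q⁻¹).toReal) := fun a b hab => by
    rw [normOn_transplant n q hab, Real.div_rpow (by linarith) (by norm_num), ← neg_add',
      Real.rpow_neg (by norm_num)]
    ring
  constructor
  · intro a b hab f hf
    rw [key a b hab]
    apply le_of_eq
    ring
  · intro K hK
    obtain ⟨f, hf, hfg⟩ := exists_isRegular hn p (zero_lt_one (α := ℝ))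
      (continuous_const (y := (1 : ℝ)))
    have h := hK 0 1 zero_lt_one f hf
    have hpos : 0 < normOn (derivOn n f 0 1) p 0 1 := by
      rw [normOn_congr hfg]
      exact normOn_pos hp zero_lt_one continuous_const
        (Set.left_mem_Icc.2 zero_le_one) one_ne_zero
    rw [key 0 1 zero_lt_one, sub_zero, Real.one_rpow, mul_one, mul_one, mul_div_assoc,
      mul_comm K] at h
    exact le_of_mul_le_mul_left h hpos

lemma errorConst_eq {n : ℕ} (hn : 1 ≤ n) {p q : ℝ≥0∞} (hp : p ≠ 0) (ψ : ℝ[X]) :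
    errorConst n p q ψ =
      (2 : ℝ) ^ (-(n : ℝ) - (q⁻¹).toReal) * normOn (fun x => ψ.eval x) q (-1) 1 /
        (n.factorial : ℝ) :=
  (isLeast_admissibleConstants hn hp ψ).csInf_eq

lemma isMinimizer_iff {n : ℕ} (hn : 1 ≤ n) {p q : ℝ≥0∞} (hp : p ≠ 0) (ψ : ℝ[X]) :
    IsMinimizer n p q ψ ↔ ψ ∈ monicPolys n ∧ ∀ χ ∈ monicPolys n,
      normOn (fun x => ψ.eval x) q (-1) 1 ≤ normOn (fun x => χ.eval x) q (-1) 1 := by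
  refine and_congr_right fun _ => forall₂_congr fun χ _ => ?_
  rw [errorConst_eq hn hp, errorConst_eq hn hp, div_le_div_iff_of_pos_right (by positivity),
    mul_le_mul_iff_right₀ (by positivity)]

lemma errorConst_mul_rpow {n : ℕ} (hn : 1 ≤ n) {p q : ℝ≥0∞} (hp : p ≠ 0) (ψ : ℝ[X]) {a b : ℝ}
    (hab : a < b) :
    errorConst n p q ψ * (b - a) ^ ((n : ℝ) + (q⁻¹).toReal) =
      normOn (fun x => (transplant n a b ψ).eval x) q a b / (n.factorial : ℝ) := by
  rw [errorConst_eq hn hp, normOn_transplant n q hab, Real.div_rpow (by linarith) (by norm_num),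
    ← neg_add', Real.rpow_neg (by norm_num)]
  ring

end ErrorConst

/-! ### The converse of Hölder's inequality -/

section Duality

variable {φ : ℝ → ℝ} {a b c : ℝ}

lemma nonneg_of_forall_abs_integral_le {p : ℝ≥0∞} (hp : p ≠ 0) (hab : a < b)
    (H : ∀ g : ℝ → ℝ, Continuous g → |∫ x in a..b, g x * φ x| ≤ c * normOn g p a b) : 0 ≤ c := by
  have h := (abs_nonneg _).trans (H (fun _ => 1) continuous_const)
  have hpos : 0 < normOn (fun _ => (1 : ℝ)) p a b :=
    normOn_pos hp hab continuous_const (Set.left_mem_Icc.2 hab.le) one_ne_zero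
  exact nonneg_of_mul_nonneg_left h hpos

lemma normOn_top_le_of_forall_abs_integral_le (hφ : Continuous φ) (hab : a < b)
    (H : ∀ g : ℝ → ℝ, Continuous g → |∫ x in a..b, g x * φ x| ≤ c * normOn g 1 a b) :
    normOn φ ∞ a b ≤ c := by
  have hc : 0 ≤ c := nonneg_of_forall_abs_integral_le one_ne_zero hab H
  by_contra! hlt
  obtain ⟨μ, hcμ, hμM⟩ := exists_between hlt
  have hμ : 0 ≤ μ := hc.trans hcμ.le
  obtain ⟨x, hx, hxμ⟩ : ∃ x ∈ Set.Icc a b, μ < |φ x| := by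
    by_contra! hle
    exact hμM.not_ge (normOn_top_le hμ hle)
  -- Soft thresholding of `φ` at a level `μ` strictly between `c` and the norm: `g` is continuous,
  -- lives where `|φ| > μ` and has the sign of `φ` there, so `g φ ≥ μ |g|`.
  set g : ℝ → ℝ := fun x => max (φ x - μ) 0 - max (-φ x - μ) 0 with hg
  have hgc : Continuous g := by fun_prop
  have hgx : g x ≠ 0 := by
    rcases lt_abs.1 hxμ with h | h
    · have h1 : max (φ x - μ) 0 = φ x - μ := max_eq_left (by linarith)
      have h2 : max (-φ x - μ) 0 = 0 := max_eq_right (by linarith)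
      simp only [hg, h1, h2]
      linarith
    · have h1 : max (φ x - μ) 0 = 0 := max_eq_right (by linarith)
      have h2 : max (-φ x - μ) 0 = -φ x - μ := max_eq_left (by linarith)
      simp only [hg, h1, h2]
      linarith
  have hpos := normOn_pos one_ne_zero hab hgc hx hgx
  have hle : ∀ y, μ * |g y| ≤ g y * φ y := fun y => by
    simp only [hg]
    rcases le_total μ (φ y) with h | h
    · rw [max_eq_left (by linarith : (0 : ℝ) ≤ φ y - μ),
        max_eq_right (by linarith : -φ y - μ ≤ 0), sub_zero, abs_of_nonneg (by linarith)]
      nlinarith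
    · rw [max_eq_right (by linarith : φ y - μ ≤ 0)]
      rcases le_total μ (-φ y) with h' | h'
      · rw [max_eq_left (by linarith : (0 : ℝ) ≤ -φ y - μ), zero_sub, abs_neg,
          abs_of_nonneg (by linarith)]
        nlinarith
      · rw [max_eq_right (by linarith : -φ y - μ ≤ 0)]
        simp
  have h1 : μ * normOn g 1 a b ≤ ∫ x in a..b, g x * φ x := by
    rw [normOn_one_eq hgc hab.le, ← intervalIntegral.integral_const_mul]
    exact intervalIntegral.integral_mono hab.le
      (Continuous.intervalIntegrable (by fun_prop) _ _)
      (Continuous.intervalIntegrable (by fun_prop) _ _) hle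
  have h2 := (h1.trans (le_abs_self _)).trans (H g hgc)
  exact hcμ.not_ge (le_of_mul_le_mul_right h2 hpos)

lemma normOn_one_le_of_forall_abs_integral_le (hφ : Continuous φ) (hab : a < b)
    (H : ∀ g : ℝ → ℝ, Continuous g → |∫ x in a..b, g x * φ x| ≤ c * normOn g ∞ a b) :
    normOn φ 1 a b ≤ c := by
  have hc : 0 ≤ c := nonneg_of_forall_abs_integral_le (by simp) hab H
  have hba : 0 < b - a := by linarith
  refine le_of_forall_pos_le_add fun δ hδ => ?_
  -- The regularized sign `φ / (|φ| + ε)` loses at most `ε` at each point, hence at most `δ` in the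
  -- integral.
  set ε := δ / (b - a) with hε
  have hεpos : 0 < ε := by positivity
  have hden : ∀ x, 0 < |φ x| + ε := fun x => by positivity
  set g : ℝ → ℝ := fun x => φ x / (|φ x| + ε) with hg
  have hgc : Continuous g := hφ.div (by fun_prop) fun x => (hden x).ne'
  have hg1 : normOn g ∞ a b ≤ 1 := by
    refine normOn_top_le zero_le_one fun x _ => ?_
    rw [hg, abs_div, abs_of_pos (hden x), div_le_one (hden x)]
    linarith
  have hle : ∀ x, |φ x| - ε ≤ g x * φ x := fun x => by
    rw [hg, div_mul_eq_mul_div, le_div_iff₀ (hden x), ← abs_mul_abs_self (φ x)]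
    nlinarith [sq_nonneg ε]
  have h1 : ∫ x in a..b, (|φ x| - ε) ≤ ∫ x in a..b, g x * φ x :=
    intervalIntegral.integral_mono hab.le (Continuous.intervalIntegrable (by fun_prop) _ _)
      (Continuous.intervalIntegrable (by fun_prop) _ _) hle
  rw [intervalIntegral.integral_sub (Continuous.intervalIntegrable (by fun_prop) _ _)
    (by simp), intervalIntegral.integral_const, ← normOn_one_eq hφ hab.le, smul_eq_mul,
    show (b - a) * ε = δ by rw [hε]; field_simp] at h1
  have h2 := (h1.trans (le_abs_self _)).trans (H g hgc)
  have h3 : c * normOn g ∞ a b ≤ c * 1 := mul_le_mul_of_nonneg_left hg1 hc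
  linarith

lemma normOn_le_of_forall_abs_integral_le_of_ne_top {p q : ℝ≥0∞} (hpq : p.HolderConjugate q)
    (hp : p ≠ ∞) (hq : q ≠ ∞) (hφ : Continuous φ) (hab : a < b)
    (H : ∀ g : ℝ → ℝ, Continuous g → |∫ x in a..b, g x * φ x| ≤ c * normOn g p a b) :
    normOn φ q a b ≤ c := by
  have hp0 : p ≠ 0 := ENNReal.HolderConjugate.ne_zero p q
  have hq0 : q ≠ 0 := ENNReal.HolderConjugate.ne_zero q p
  have hc : 0 ≤ c := nonneg_of_forall_abs_integral_le hp0 hab H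
  have hR : p.toReal.HolderConjugate q.toReal := ENNReal.HolderConjugate.toReal_of_ne_top hp hq
  have hQ : 0 < q.toReal - 1 := by linarith [hR.symm.lt]
  -- This is `sign φ * |φ| ^ (q - 1)`, the equality case of Hölder, split into positive and negative
  -- parts so that continuity is evident.
  set g : ℝ → ℝ := fun x => max (φ x) 0 ^ (q.toReal - 1) - max (-φ x) 0 ^ (q.toReal - 1) with hg
  have hgc : Continuous g :=
    ((hφ.max continuous_const).rpow_const fun _ => Or.inr hQ.le).sub
      ((hφ.neg.max continuous_const).rpow_const fun _ => Or.inr hQ.le)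
  have habs : ∀ x, |g x| = |φ x| ^ (q.toReal - 1) ∧ g x * φ x = |φ x| ^ q.toReal := fun x => by
    have hmul : ∀ t : ℝ, 0 ≤ t → t ^ (q.toReal - 1) * t = t ^ q.toReal := fun t ht => by
      conv_lhs => rw [← Real.rpow_one t, ← Real.rpow_mul ht, one_mul]
      rw [← Real.rpow_add_of_nonneg ht hQ.le zero_le_one, sub_add_cancel]
    simp only [hg]
    rcases le_total 0 (φ x) with h | h
    · rw [max_eq_left h, max_eq_right (by linarith : -φ x ≤ 0), Real.zero_rpow hQ.ne', sub_zero,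
        abs_of_nonneg (Real.rpow_nonneg h _), abs_of_nonneg h]
      exact ⟨rfl, hmul _ h⟩
    · have h' : 0 ≤ -φ x := by linarith
      rw [max_eq_right h, max_eq_left h', Real.zero_rpow hQ.ne', zero_sub, abs_neg,
        abs_of_nonneg (Real.rpow_nonneg h' _), abs_of_nonpos h, neg_mul_comm]
      exact ⟨rfl, hmul _ h'⟩
  have hgp : ∀ x, |g x| ^ p.toReal = |φ x| ^ q.toReal := fun x => by
    rw [(habs x).1, ← Real.rpow_mul (abs_nonneg _), hR.symm.sub_one_mul_conj]
  have h := (le_abs_self _).trans (H g hgc)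
  rw [normOn_eq_rpow hgc hp0 hp hab.le] at h
  simp only [hgp, (habs _).2] at h
  rw [normOn_eq_rpow hφ hq0 hq hab.le]
  set I := ∫ x in a..b, |φ x| ^ q.toReal with hI
  have hI0 : 0 ≤ I := intervalIntegral.integral_nonneg hab.le fun x _ => by positivity
  -- The hypothesis now reads `I ≤ c * I ^ (1/p)`; cancelling the power needs `I > 0`.
  rcases hI0.eq_or_lt with h0 | hpos
  · rw [← h0, Real.zero_rpow (inv_ne_zero hR.symm.ne_zero)]
    exact hc
  · have hsplit : I = I ^ q.toReal⁻¹ * I ^ p.toReal⁻¹ := by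
      rw [← Real.rpow_add hpos, add_comm, hR.inv_add_inv_eq_one, Real.rpow_one]
    refine le_of_mul_le_mul_right ?_ (Real.rpow_pos_of_pos hpos p.toReal⁻¹)
    rwa [← hsplit]

/-- The converse of Hölder's inequality, tested on continuous functions. -/
lemma normOn_le_of_forall_abs_integral_le {p q : ℝ≥0∞} (hpq : p.HolderConjugate q)
    (hφ : Continuous φ) (hab : a < b)
    (H : ∀ g : ℝ → ℝ, Continuous g → |∫ x in a..b, g x * φ x| ≤ c * normOn g p a b) :
    normOn φ q a b ≤ c := by
  rcases eq_or_ne q ∞ with rfl | hq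
  · obtain rfl : p = 1 := (ENNReal.HolderConjugate.eq_top_iff_eq_one ∞ p).1 rfl
    exact normOn_top_le_of_forall_abs_integral_le hφ hab H
  rcases eq_or_ne p ∞ with rfl | hp
  · obtain rfl : q = 1 := (ENNReal.HolderConjugate.eq_top_iff_eq_one ∞ q).1 rfl
    exact normOn_one_le_of_forall_abs_integral_le hφ hab H
  exact normOn_le_of_forall_abs_integral_le_of_ne_top hpq hp hq hφ hab H

end Duality

/-! ### Sharpness of the error estimate -/

lemma isLeast_errorTerm_bound {n : ℕ} (hn : 1 ≤ n) {p q : ℝ≥0∞} (hpq : p.HolderConjugate q)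
    {a b : ℝ} (hab : a < b) (φ : ℝ[X]) :
    IsLeast {c : ℝ | ∀ f : ℝ → ℝ, IsRegular n p a b f →
        |errorTerm n φ f a b| ≤ c * normOn (derivOn n f a b) p a b}
      (normOn (fun x => φ.eval x) q a b / (n.factorial : ℝ)) := by
  constructor
  · intro f hf
    refine (abs_errorTerm_le hpq hab hf φ).trans (le_of_eq ?_)
    ring
  · intro c hc
    rw [div_le_iff₀ (by positivity)]
    refine normOn_le_of_forall_abs_integral_le hpq φ.continuous hab fun g hg => ?_
    obtain ⟨f, hf, hfg⟩ := exists_isRegular hn p hab hg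
    have h := hc f hf
    have hint : ∫ x in a..b, derivOn n f a b x * φ.eval x = ∫ x in a..b, g x * φ.eval x := by
      refine intervalIntegral.integral_congr fun x hx => ?_
      rw [Set.uIcc_of_le hab.le] at hx
      simp only [hfg x hx]
    rw [normOn_congr hfg, errorTerm, hint, abs_mul, abs_div, abs_pow, abs_neg, abs_one, one_pow,
      Nat.abs_cast, one_div, inv_mul_le_iff₀ (by positivity)] at h
    linarith

/-! ### Monic polynomials as an affine space -/

lemma degree_sub_lt_of_mem_monicPolys {n : ℕ} {ψ χ : ℝ[X]} (hψ : ψ ∈ monicPolys n)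
    (hχ : χ ∈ monicPolys n) : (ψ - χ).degree < n := by
  have h1 : ψ.degree = n := by rw [degree_eq_natDegree hψ.1.ne_zero, hψ.2]
  have h2 : χ.degree = n := by rw [degree_eq_natDegree hχ.1.ne_zero, hχ.2]
  have := degree_sub_lt_left (h1.trans h2.symm) hψ.1.ne_zero
    (hψ.1.leadingCoeff.trans hχ.1.leadingCoeff.symm)
  rwa [h1] at this

lemma add_mem_monicPolys {n : ℕ} {ψ r : ℝ[X]} (hψ : ψ ∈ monicPolys n) (hr : r.degree < n) :
    ψ + r ∈ monicPolys n := by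
  have h1 : ψ.degree = n := by rw [degree_eq_natDegree hψ.1.ne_zero, hψ.2]
  have hlt : r.degree < ψ.degree := by rwa [h1]
  exact ⟨hψ.1.add_of_left hlt, by rw [natDegree_add_eq_left_of_degree_lt hlt, hψ.2]⟩

lemma X_pow_mem_monicPolys (n : ℕ) : (X ^ n : ℝ[X]) ∈ monicPolys n :=
  ⟨monic_X_pow n, natDegree_X_pow n⟩

lemma midpoint_mem_monicPolys {n : ℕ} {ψ χ : ℝ[X]} (hψ : ψ ∈ monicPolys n)
    (hχ : χ ∈ monicPolys n) : ψ + C (1 / 2) * (χ - ψ) ∈ monicPolys n := by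
  refine add_mem_monicPolys hψ ?_
  rw [degree_C_mul (by norm_num)]
  exact degree_sub_lt_of_mem_monicPolys hχ hψ

lemma eval_midpoint (ψ χ : ℝ[X]) (x : ℝ) :
    (ψ + C (1 / 2) * (χ - ψ)).eval x = (ψ.eval x + χ.eval x) / 2 := by
  simp
  ring

lemma eq_of_eval_eq_on_Icc {ψ χ : ℝ[X]} (h : ∀ x ∈ Set.Icc (-1 : ℝ) 1, ψ.eval x = χ.eval x) :
    ψ = χ :=
  eq_of_infinite_eval_eq ψ χ ((Set.Icc_infinite (by norm_num)).mono h)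

/-! ### Existence of a polynomial of least norm -/

section Existence

/-- A polynomial as an element of `L^q([-1, 1])`. -/
def toLpLinear (q : ℝ≥0∞) : ℝ[X] →ₗ[ℝ] Lp ℝ q (volume.restrict (Set.Icc (-1 : ℝ) 1)) where
  toFun P := (memLp_of_continuous P.continuous q (-1) 1).toLp
  map_add' P Q := by
    rw [← MemLp.toLp_add]
    congr 1
    funext x
    simp
  map_smul' c P := by
    rw [RingHom.id_apply, ← MemLp.toLp_const_smul]
    congr 1
    funext x
    simp

lemma norm_toLpLinear (q : ℝ≥0∞) (P : ℝ[X]) :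
    ‖toLpLinear q P‖ = normOn (fun x => P.eval x) q (-1) 1 := by
  rw [normOn, lpNorm, if_pos P.continuous.aestronglyMeasurable]
  exact Lp.norm_toLp _ (memLp_of_continuous P.continuous q (-1) 1)

lemma exists_normOn_le (n : ℕ) {q : ℝ≥0∞} (hq : 1 ≤ q) :
    ∃ ψ ∈ monicPolys n, ∀ χ ∈ monicPolys n,
      normOn (fun x => ψ.eval x) q (-1) 1 ≤ normOn (fun x => χ.eval x) q (-1) 1 := by
  have : Fact (1 ≤ q) := ⟨hq⟩
  -- Monic polynomials correspond to the translate `x₀ + V`. As `V` is finite-dimensional, the norm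
  -- on this translate is continuous and coercive, so it attains its minimum.
  let V := (degreeLT ℝ n).map (toLpLinear q)
  have : FiniteDimensional ℝ (degreeLT ℝ n) := (degreeLTEquiv ℝ n).symm.finiteDimensional
  have : ProperSpace V := FiniteDimensional.proper ℝ V
  let x₀ := toLpLinear q (X ^ n)
  have hcont : Continuous fun v : V => ‖x₀ + v‖ := by fun_prop
  have hlim : Filter.Tendsto (fun v : V => ‖x₀ + v‖) (Filter.cocompact V) Filter.atTop := by
    refine Filter.tendsto_atTop_mono (f := fun v : V => ‖v‖ - ‖x₀‖) (fun v => ?_)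
      (Filter.tendsto_atTop_add_const_right _ _ (tendsto_norm_cocompact_atTop (E := V)))
    have := norm_sub_le (x₀ + v) x₀
    rw [add_sub_cancel_left] at this
    simp only [Submodule.coe_norm]
    linarith
  obtain ⟨⟨v, r, hr, rfl⟩, hv⟩ := hcont.exists_forall_le hlim
  refine ⟨X ^ n + r, add_mem_monicPolys (X_pow_mem_monicPolys n) (mem_degreeLT.1 hr),
    fun χ hχ => ?_⟩
  have hmem : χ - X ^ n ∈ degreeLT ℝ n :=
    mem_degreeLT.2 (degree_sub_lt_of_mem_monicPolys hχ (X_pow_mem_monicPolys n))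
  have h := hv ⟨_, Submodule.mem_map_of_mem hmem⟩
  simp only [x₀, ← map_add, add_sub_cancel] at h
  rwa [norm_toLpLinear, norm_toLpLinear] at h

end Existence

/-! ### Uniqueness of the polynomial of least norm -/

section Uniqueness

variable {n : ℕ} {ψ χ : ℝ[X]}

/-- Comparison with the monic multiple of `T_n` shows that `2 ^ (n - 1) * ψ` is bounded by 1 on
`[-1, 1]`. Its leading coefficient is the largest possible under that bound, which only `T_n`
attains. -/
lemma chebyshev_eq_of_normOn_top_le (hψ : ψ ∈ monicPolys n)
    (hmin : ∀ χ ∈ monicPolys n,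
      normOn (fun x => ψ.eval x) ∞ (-1) 1 ≤ normOn (fun x => χ.eval x) ∞ (-1) 1) :
    C (2 ^ (n - 1)) * ψ = Chebyshev.T ℝ n := by
  have h2 : (0 : ℝ) < 2 ^ (n - 1) := by positivity
  have hT : C ((2 ^ (n - 1))⁻¹) * Chebyshev.T ℝ n ∈ monicPolys n := by
    constructor
    · rw [Monic, leadingCoeff_mul, leadingCoeff_C, Chebyshev.leadingCoeff_T, Int.natAbs_natCast]
      exact inv_mul_cancel₀ h2.ne'
    · rw [natDegree_C_mul (inv_ne_zero h2.ne'), Chebyshev.natDegree_T, Int.natAbs_natCast]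
  have hTle : normOn (fun x => (C ((2 ^ (n - 1))⁻¹) * Chebyshev.T ℝ n).eval x) ∞ (-1) 1 ≤
      ((2 : ℝ) ^ (n - 1))⁻¹ := by
    refine normOn_top_le (by positivity) fun x hx => ?_
    rw [eval_mul, eval_C, abs_mul, abs_of_pos (inv_pos.2 h2)]
    exact mul_le_of_le_one_right (inv_pos.2 h2).le
      (Chebyshev.abs_eval_T_real_le_one n (abs_le.2 hx))
  refine (Chebyshev.coeff_eq_iff_of_forall_abs_le_one ?_ fun x hx => ?_).1 ?_
  · rw [degree_C_mul h2.ne', degree_eq_natDegree hψ.1.ne_zero, hψ.2]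
  · rw [eval_mul, eval_C, abs_mul, abs_of_pos h2, ← le_inv_mul_iff₀ h2, mul_one]
    exact (abs_le_normOn_top ψ.continuous (by norm_num) hx).trans ((hmin _ hT).trans hTle)
  · have : ψ.coeff n = 1 := by
      rw [← hψ.2]
      exact hψ.1
    rw [coeff_C_mul, this, mul_one]

lemma abs_midpoint_rpow_le {Q : ℝ} (hQ : 1 ≤ Q) (x y : ℝ) :
    |(x + y) / 2| ^ Q ≤ (|x| ^ Q + |y| ^ Q) / 2 := by
  have h1 : |(x + y) / 2| ≤ (|x| + |y|) / 2 := by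
    rw [abs_div, abs_two]
    linarith [abs_add_le x y]
  have h2 := (convexOn_rpow hQ).2 (abs_nonneg x) (abs_nonneg y)
    (by norm_num : (0 : ℝ) ≤ 1 / 2) (by norm_num : (0 : ℝ) ≤ 1 / 2) (by norm_num)
  simp only [smul_eq_mul] at h2
  rw [show 1 / 2 * |x| + 1 / 2 * |y| = (|x| + |y|) / 2 by ring] at h2
  have h3 := Real.rpow_le_rpow (abs_nonneg _) h1 (by linarith : 0 ≤ Q)
  linarith

lemma abs_midpoint_rpow_lt {Q : ℝ} (hQ : 1 < Q) {x y : ℝ} (hxy : x ≠ y) :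
    |(x + y) / 2| ^ Q < (|x| ^ Q + |y| ^ Q) / 2 := by
  rcases eq_or_ne |x| |y| with h | h
  -- Strict convexity of `t ^ Q` says nothing when `|x| = |y|`; then the midpoint is 0.
  · obtain rfl : x = -y := (abs_eq_abs.1 h).resolve_left hxy
    have hy : y ≠ 0 := by
      rintro rfl
      simp at hxy
    have := Real.rpow_pos_of_pos (abs_pos.2 hy) Q
    rw [neg_add_cancel, zero_div, abs_zero, Real.zero_rpow (by linarith), abs_neg]
    linarith
  · have h1 : |(x + y) / 2| ≤ (|x| + |y|) / 2 := by
      rw [abs_div, abs_two]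
      linarith [abs_add_le x y]
    have h2 := (strictConvexOn_rpow hQ).2 (abs_nonneg x) (abs_nonneg y) h
      (by norm_num : (0 : ℝ) < 1 / 2) (by norm_num : (0 : ℝ) < 1 / 2) (by norm_num)
    simp only [smul_eq_mul] at h2
    rw [show 1 / 2 * |x| + 1 / 2 * |y| = (|x| + |y|) / 2 by ring] at h2
    have h3 := Real.rpow_le_rpow (abs_nonneg _) h1 (by linarith : 0 ≤ Q)
    linarith

/-- Equality in the convexity inequality for two minimizers of the `L^q` norm. -/
lemma abs_midpoint_rpow_eq {q : ℝ≥0∞} (hq : 1 ≤ q) (hq' : q ≠ ∞)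
    (hψ : ψ ∈ monicPolys n) (hχ : χ ∈ monicPolys n)
    (hψmin : ∀ ω ∈ monicPolys n,
      normOn (fun x => ψ.eval x) q (-1) 1 ≤ normOn (fun x => ω.eval x) q (-1) 1)
    (hχmin : ∀ ω ∈ monicPolys n,
      normOn (fun x => χ.eval x) q (-1) 1 ≤ normOn (fun x => ω.eval x) q (-1) 1)
    {x : ℝ} (hx : x ∈ Set.Icc (-1 : ℝ) 1) :
    |(ψ.eval x + χ.eval x) / 2| ^ q.toReal =
      (|ψ.eval x| ^ q.toReal + |χ.eval x| ^ q.toReal) / 2 := by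
  have hQ : 1 ≤ q.toReal := by
    simpa using ENNReal.toReal_mono hq' hq
  have hq0 : q ≠ 0 := (zero_lt_one.trans_le hq).ne'
  have hQ0 : 0 < q.toReal := by linarith
  have hcont : ∀ ω : ℝ[X], Continuous fun x => |ω.eval x| ^ q.toReal := fun ω =>
    ω.continuous.abs.rpow_const fun _ => Or.inr hQ0.le
  have hmono : ∀ ω η : ℝ[X],
      normOn (fun x => ω.eval x) q (-1) 1 ≤ normOn (fun x => η.eval x) q (-1) 1 →
      ∫ x in (-1 : ℝ)..1, |ω.eval x| ^ q.toReal ≤ ∫ x in (-1 : ℝ)..1, |η.eval x| ^ q.toReal := by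
    intro ω η h
    rw [normOn_eq_rpow ω.continuous hq0 hq' (by norm_num),
      normOn_eq_rpow η.continuous hq0 hq' (by norm_num)] at h
    refine (Real.rpow_le_rpow_iff ?_ ?_ (inv_pos.2 hQ0)).1 h <;>
    exact intervalIntegral.integral_nonneg (by norm_num) fun x _ => by positivity
  have hm := midpoint_mem_monicPolys hψ hχ
  have h1 := hmono _ _ (hψmin _ hm)
  have h2 := hmono _ _ (hχmin _ hm)
  simp only [eval_midpoint] at h1 h2
  have hcm : Continuous fun x => |(ψ.eval x + χ.eval x) / 2| ^ q.toReal :=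
    (show Continuous fun x => |(ψ.eval x + χ.eval x) / 2| by fun_prop).rpow_const
      fun _ => Or.inr hQ0.le
  have hca : Continuous fun x => (|ψ.eval x| ^ q.toReal + |χ.eval x| ^ q.toReal) / 2 :=
    ((hcont ψ).add (hcont χ)).div_const 2
  -- The midpoint competes with both minimizers, so the nonnegative convexity defect has integral at
  -- most 0 and vanishes pointwise.
  have h := eq_zero_of_integral_nonpos
    (g := fun x => (|ψ.eval x| ^ q.toReal + |χ.eval x| ^ q.toReal) / 2 -
      |(ψ.eval x + χ.eval x) / 2| ^ q.toReal)
    (hca.sub hcm) (by norm_num)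
    (fun x => sub_nonneg.2 (abs_midpoint_rpow_le hQ _ _)) ?_ hx
  · linarith
  · rw [intervalIntegral.integral_sub (hca.intervalIntegrable _ _)
      (hcm.intervalIntegrable _ _), intervalIntegral.integral_div,
      intervalIntegral.integral_add ((hcont ψ).intervalIntegrable _ _)
      ((hcont χ).intervalIntegrable _ _)]
    linarith

/-- A nonzero polynomial is a product of distinct linear factors with roots in `[-1, 1]` and a
polynomial of constant sign on `[-1, 1]`. -/
lemma exists_eq_prod_mul_of_ne_zero (φ : ℝ[X]) (hφ : φ ≠ 0) :
    ∃ (T : Finset ℝ) (s : ℝ[X]), φ = (∏ c ∈ T, (X - C c)) * s ∧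
      (∀ c ∈ T, c ∈ Set.Icc (-1 : ℝ) 1) ∧
      ((∀ x ∈ Set.Icc (-1 : ℝ) 1, 0 ≤ s.eval x) ∨ ∀ x ∈ Set.Icc (-1 : ℝ) 1, s.eval x ≤ 0) := by
  induction hd : φ.natDegree using Nat.strong_induction_on generalizing φ with
  | _ d ih =>
  by_cases hroot : ∃ c ∈ Set.Icc (-1 : ℝ) 1, φ.eval c = 0
  · obtain ⟨c, hc, hc0⟩ := hroot
    obtain ⟨φ', rfl⟩ := dvd_iff_isRoot.2 hc0
    have hφ' : φ' ≠ 0 := right_ne_zero_of_mul hφ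
    obtain ⟨T, s, hTs, hT, hs⟩ := ih φ'.natDegree
      (by rw [← hd, natDegree_mul (X_sub_C_ne_zero c) hφ', natDegree_X_sub_C]; omega) φ' hφ' rfl
    by_cases hcT : c ∈ T
    -- A repeated factor forms a square, which joins `s` without changing its sign; `T` keeps the
    -- roots of odd multiplicity.
    · refine ⟨T.erase c, (X - C c) ^ 2 * s, ?_, fun x hx => hT x (Finset.mem_of_mem_erase hx), ?_⟩
      · rw [hTs, ← Finset.mul_prod_erase T _ hcT]
        ring
      · refine hs.imp (fun h x hx => ?_) (fun h x hx => ?_) <;>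
        simp only [eval_mul, eval_pow, eval_sub, eval_X, eval_C]
        · exact mul_nonneg (sq_nonneg _) (h x hx)
        · exact mul_nonpos_of_nonneg_of_nonpos (sq_nonneg _) (h x hx)
    · refine ⟨insert c T, s, ?_, fun x hx => ?_, hs⟩
      · rw [Finset.prod_insert hcT, hTs, mul_assoc]
      · rcases Finset.mem_insert.1 hx with rfl | h
        · exact hc
        · exact hT x h
  · refine ⟨∅, φ, by simp, by simp, ?_⟩
    by_contra! h
    obtain ⟨⟨x, hx, hx0⟩, y, hy, hy0⟩ := h
    obtain ⟨z, hz, hz0⟩ := isPreconnected_Icc.intermediate_value hx hy φ.continuous.continuousOn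
      (show (0 : ℝ) ∈ Set.Icc _ _ from ⟨hx0.le, hy0.le⟩)
    exact hroot ⟨z, hz, hz0⟩

/-- With `ε = 1 / (k + 1)`, this is the one-sided derivative at `ε = 0` of the integral of `|r| * |u
- ε|`. The difference quotients are dominated by `|r|` and tend to `-|r|` off the finitely many
zeros of `u`. -/
lemma tendsto_integral_abs_sub_sub_div {r u : ℝ[X]} (hu : u ≠ 0)
    (hpos : ∀ x ∈ Set.Icc (-1 : ℝ) 1, 0 ≤ u.eval x) :
    Filter.Tendsto (fun k : ℕ => ∫ x in (-1 : ℝ)..1,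
      |r.eval x| * ((|u.eval x - 1 / ((k : ℝ) + 1)| - u.eval x) * ((k : ℝ) + 1)))
      Filter.atTop (nhds (∫ x in (-1 : ℝ)..1, |r.eval x| * (-1))) := by
  refine intervalIntegral.tendsto_integral_filter_of_dominated_convergence
    (fun x => |r.eval x|) (Filter.Eventually.of_forall fun k => ?_)
    (Filter.Eventually.of_forall fun k => Filter.Eventually.of_forall fun x hx => ?_)
    (Continuous.intervalIntegrable (by fun_prop) _ _) ?_
  · exact Continuous.aestronglyMeasurable (by fun_prop)
  · rw [Set.uIoc_of_le (by norm_num)] at hx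
    have hk : (0 : ℝ) < (k : ℝ) + 1 := by positivity
    have hux := hpos x ⟨hx.1.le, hx.2⟩
    have hbd : |(|u.eval x - 1 / ((k : ℝ) + 1)| - u.eval x)| ≤ 1 / ((k : ℝ) + 1) := by
      have := abs_abs_sub_abs_le (u.eval x - 1 / ((k : ℝ) + 1)) (u.eval x)
      rwa [abs_of_nonneg hux, sub_sub_cancel_left, abs_neg,
        abs_of_pos (one_div_pos.2 hk)] at this
    rw [norm_mul, norm_mul, Real.norm_eq_abs, abs_abs, Real.norm_eq_abs, Real.norm_eq_abs,
      abs_of_pos hk]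
    refine mul_le_of_le_one_right (abs_nonneg _) ?_
    rwa [← le_div_iff₀ hk]
  · have hfin : {x : ℝ | u.eval x = 0}.Finite := by
      refine (u.roots.toFinset.finite_toSet).subset fun x hx => ?_
      simpa [hu] using hx
    filter_upwards [measure_eq_zero_iff_ae_notMem.1 (hfin.measure_zero volume)] with x hx0 hx
    rw [Set.uIoc_of_le (by norm_num)] at hx
    have hux : 0 < u.eval x := lt_of_le_of_ne (hpos x ⟨hx.1.le, hx.2⟩) (Ne.symm hx0)
    refine tendsto_const_nhds.congr' ?_
    have hev := (tendsto_one_div_add_atTop_nhds_zero_nat (𝕜 := ℝ)).eventually (gt_mem_nhds hux)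
    filter_upwards [hev] with k hk
    have hk1 : (0 : ℝ) < (k : ℝ) + 1 := by positivity
    rw [abs_of_pos (sub_pos.2 hk), sub_sub_cancel_left, neg_mul, one_div_mul_cancel hk1.ne']

/-- A monic polynomial of least `L^1` norm has as many distinct roots in `[-1, 1]` as its
degree. -/
lemma exists_roots_of_normOn_one_le (hψ : ψ ∈ monicPolys n)
    (hmin : ∀ χ ∈ monicPolys n,
      normOn (fun x => ψ.eval x) 1 (-1) 1 ≤ normOn (fun x => χ.eval x) 1 (-1) 1) :
    ∃ T : Finset ℝ, n ≤ T.card ∧ ∀ c ∈ T, c ∈ Set.Icc (-1 : ℝ) 1 ∧ ψ.eval c = 0 := by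
  obtain ⟨T, s, hTs, hT, hs⟩ := exists_eq_prod_mul_of_ne_zero ψ hψ.1.ne_zero
  refine ⟨T, ?_, fun c hc => ⟨hT c hc, ?_⟩⟩
  swap
  · rw [hTs, eval_mul, eval_prod, Finset.prod_eq_zero hc (by simp), zero_mul]
  -- With fewer than `n` factors, `r` has degree below `n`, so `ψ - σ ε r` is a competitor. Writing
  -- `ψ = σ r u` with `u ≥ 0`, its norm is the integral of `|r| * |u - ε|`, whose derivative at `ε =
  -- 0` is minus the norm of `r`, contradicting minimality.
  by_contra! hlt
  set r : ℝ[X] := ∏ c ∈ T, (X - C c) with hr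
  have hrm : r.Monic := monic_prod_of_monic _ _ fun c _ => monic_X_sub_C c
  have hrd : r.degree < n := by
    rw [hr, degree_prod]
    simpa using hlt
  obtain ⟨σ, u, hσ, hsu, hu⟩ : ∃ (σ : ℝ) (u : ℝ[X]), |σ| = 1 ∧ s = C σ * u ∧
      ∀ x ∈ Set.Icc (-1 : ℝ) 1, 0 ≤ u.eval x := by
    rcases hs with h | h
    · exact ⟨1, s, by simp, by simp, h⟩
    · exact ⟨-1, -s, by simp, by simp, fun x hx => by simpa using h x hx⟩
  have hσ0 : σ ≠ 0 := by
    rintro rfl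
    simp at hσ
  have hu0 : u ≠ 0 := by
    rintro rfl
    exact hψ.1.ne_zero (by rw [hTs, hsu]; simp)
  have hnonneg : ∀ k : ℕ, 0 ≤ ∫ x in (-1 : ℝ)..1,
      |r.eval x| * ((|u.eval x - 1 / ((k : ℝ) + 1)| - u.eval x) * ((k : ℝ) + 1)) := by
    intro k
    have hk : (0 : ℝ) < (k : ℝ) + 1 := by positivity
    have hmem : ψ + C (-(σ * (1 / ((k : ℝ) + 1)))) * r ∈ monicPolys n := by
      refine add_mem_monicPolys hψ ?_
      rwa [degree_C_mul (by simp [hσ0, hk.ne'])]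
    have h := hmin _ hmem
    rw [normOn_one_eq ψ.continuous (by norm_num),
      normOn_one_eq (Polynomial.continuous _) (by norm_num)] at h
    have e1 : ∫ x in (-1 : ℝ)..1, |ψ.eval x| = ∫ x in (-1 : ℝ)..1, |r.eval x| * u.eval x := by
      refine intervalIntegral.integral_congr fun x hx => ?_
      rw [Set.uIcc_of_le (by norm_num)] at hx
      simp only [hTs, hsu, eval_mul, eval_C, abs_mul, hσ, one_mul, abs_of_nonneg (hu x hx)]
    have e2 : ∫ x in (-1 : ℝ)..1, |(ψ + C (-(σ * (1 / ((k : ℝ) + 1)))) * r).eval x| =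
        ∫ x in (-1 : ℝ)..1, |r.eval x| * |u.eval x - 1 / ((k : ℝ) + 1)| := by
      refine intervalIntegral.integral_congr fun x _ => ?_
      simp only [hTs, hsu, eval_add, eval_mul, eval_C]
      rw [show r.eval x * (σ * u.eval x) + -(σ * (1 / ((k : ℝ) + 1))) * r.eval x =
        σ * (r.eval x * (u.eval x - 1 / ((k : ℝ) + 1))) by ring, abs_mul, abs_mul, hσ, one_mul]
    rw [e1, e2] at h
    have e3 : ∫ x in (-1 : ℝ)..1,
        |r.eval x| * ((|u.eval x - 1 / ((k : ℝ) + 1)| - u.eval x) * ((k : ℝ) + 1)) =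
        ((∫ x in (-1 : ℝ)..1, |r.eval x| * |u.eval x - 1 / ((k : ℝ) + 1)|) -
          ∫ x in (-1 : ℝ)..1, |r.eval x| * u.eval x) * ((k : ℝ) + 1) := by
      rw [← intervalIntegral.integral_sub (Continuous.intervalIntegrable (by fun_prop) _ _)
        (Continuous.intervalIntegrable (by fun_prop) _ _), ← intervalIntegral.integral_mul_const]
      refine intervalIntegral.integral_congr fun x _ => ?_
      ring
    rw [e3]
    exact mul_nonneg (sub_nonneg.2 h) hk.le
  have hlim := ge_of_tendsto' (tendsto_integral_abs_sub_sub_div (r := r) hu0 hu) hnonneg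
  rw [intervalIntegral.integral_mul_const, ← normOn_one_eq r.continuous (by norm_num)] at hlim
  obtain ⟨x, hx, hx0⟩ : ∃ x ∈ Set.Icc (-1 : ℝ) 1, r.eval x ≠ 0 := by
    by_contra! h
    exact hrm.ne_zero (eq_of_eval_eq_on_Icc fun x hx => by simpa using h x hx)
  have := normOn_pos one_ne_zero (by norm_num) r.continuous hx hx0
  linarith

lemma eq_of_normOn_le {q : ℝ≥0∞} (hq : 1 ≤ q) (hψ : ψ ∈ monicPolys n)
    (hχ : χ ∈ monicPolys n)
    (hψmin : ∀ ω ∈ monicPolys n,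
      normOn (fun x => ψ.eval x) q (-1) 1 ≤ normOn (fun x => ω.eval x) q (-1) 1)
    (hχmin : ∀ ω ∈ monicPolys n,
      normOn (fun x => χ.eval x) q (-1) 1 ≤ normOn (fun x => ω.eval x) q (-1) 1) :
    ψ = χ := by
  rcases eq_or_ne q ∞ with rfl | hq'
  · have h := (chebyshev_eq_of_normOn_top_le hψ hψmin).trans
      (chebyshev_eq_of_normOn_top_le hχ hχmin).symm
    exact mul_left_cancel₀ (C_ne_zero.2 (by positivity)) h
  have heq := fun x (hx : x ∈ Set.Icc (-1 : ℝ) 1) =>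
    abs_midpoint_rpow_eq hq hq' hψ hχ hψmin hχmin hx
  rcases hq.eq_or_lt with rfl | hlt
  · simp only [ENNReal.toReal_one, Real.rpow_one] at heq
    -- For `q = 1` strict convexity fails, but the midpoint is again a minimizer and so has `n`
    -- distinct roots. At each root the equality `heq` gives `|ψ| + |χ| = 0`, and a difference of
    -- degree below `n` cannot have `n` zeros unless it is zero.
    have hm := midpoint_mem_monicPolys hψ hχ
    have hmin : ∀ ω ∈ monicPolys n,
        normOn (fun x => (ψ + C (1 / 2) * (χ - ψ)).eval x) 1 (-1) 1 ≤
          normOn (fun x => ω.eval x) 1 (-1) 1 := by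
      intro ω hω
      have h1 := hψmin ω hω
      have h2 := hχmin ω hω
      rw [normOn_one_eq ψ.continuous (by norm_num)] at h1
      rw [normOn_one_eq χ.continuous (by norm_num)] at h2
      rw [normOn_one_eq (Polynomial.continuous _) (by norm_num)]
      have e : ∫ x in (-1 : ℝ)..1, |(ψ + C (1 / 2) * (χ - ψ)).eval x| =
          ∫ x in (-1 : ℝ)..1, (|ψ.eval x| + |χ.eval x|) / 2 := by
        refine intervalIntegral.integral_congr fun x hx => ?_
        rw [Set.uIcc_of_le (by norm_num)] at hx
        simp only [eval_midpoint, heq x hx]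
      rw [e, intervalIntegral.integral_div, intervalIntegral.integral_add
        (Continuous.intervalIntegrable (by fun_prop) _ _)
        (Continuous.intervalIntegrable (by fun_prop) _ _)]
      linarith
    obtain ⟨T, hT, hroots⟩ := exists_roots_of_normOn_one_le hm hmin
    refine eq_of_degree_sub_lt_of_eval_finset_eq T
      ((degree_sub_lt_of_mem_monicPolys hψ hχ).trans_le (by exact_mod_cast hT)) fun c hc => ?_
    obtain ⟨hcI, hc0⟩ := hroots c hc
    have h := heq c hcI
    rw [← eval_midpoint, hc0, abs_zero] at h
    have h1 := abs_nonneg (ψ.eval c)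
    have h2 := abs_nonneg (χ.eval c)
    rw [abs_eq_zero.1 (show |ψ.eval c| = 0 by linarith),
      abs_eq_zero.1 (show |χ.eval c| = 0 by linarith)]
  · refine eq_of_eval_eq_on_Icc fun x hx => ?_
    by_contra hne
    have hQ : 1 < q.toReal := by
      simpa using (ENNReal.toReal_lt_toReal ENNReal.one_ne_top hq').2 hlt
    exact (abs_midpoint_rpow_lt hQ hne).ne (heq x hx)

end Uniqueness

end CorrectedTrapezoid

end

/-! ### The main theorem -/

theorem mainTheorem1 (n : ℕ) (hn : 1 ≤ n) (p q : ℝ≥0∞) (hpq : ENNReal.HolderConjugate p q) :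
    -- the quadrature formula and the first error estimate
    (∀ (a b : ℝ), a < b → ∀ f : ℝ → ℝ, CorrectedTrapezoid.IsRegular n p a b f →
      ∀ φ ∈ CorrectedTrapezoid.monicPolys n,
        IntervalIntegrable f volume a b ∧
        IntervalIntegrable (fun x => CorrectedTrapezoid.derivOn n f a b x * φ.eval x)
          volume a b ∧
        (∫ x in a..b, f x) = CorrectedTrapezoid.quadrature n φ f a b +
          CorrectedTrapezoid.errorTerm n φ f a b ∧
        |CorrectedTrapezoid.errorTerm n φ f a b| ≤
          CorrectedTrapezoid.normOn (CorrectedTrapezoid.derivOn n f a b) p a b *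
            CorrectedTrapezoid.normOn (fun x => φ.eval x) q a b / (n.factorial : ℝ)) ∧
    -- every `φ` on `[a, b]` comes from exactly one `ψ`, and the second error estimate holds
    -- with the constant that belongs to `ψ`, which involves neither `f` nor `a`, `b`
    (∀ (a b : ℝ), a < b → ∀ φ ∈ CorrectedTrapezoid.monicPolys n,
      (∃! ψ : ℝ[X], ψ ∈ CorrectedTrapezoid.monicPolys n ∧
        φ = CorrectedTrapezoid.transplant n a b ψ) ∧
      ∀ ψ ∈ CorrectedTrapezoid.monicPolys n, φ = CorrectedTrapezoid.transplant n a b ψ →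
        ∀ f : ℝ → ℝ, CorrectedTrapezoid.IsRegular n p a b f →
          CorrectedTrapezoid.normOn (CorrectedTrapezoid.derivOn n f a b) p a b *
              CorrectedTrapezoid.normOn (fun x => φ.eval x) q a b / (n.factorial : ℝ) ≤
            CorrectedTrapezoid.errorConst n p q ψ *
              CorrectedTrapezoid.normOn (CorrectedTrapezoid.derivOn n f a b) p a b *
              (b - a) ^ ((n : ℝ) + (q⁻¹).toReal)) ∧
    -- the constant that belongs to `ψ` is the least admissible one
    (∀ ψ ∈ CorrectedTrapezoid.monicPolys n,
      (∀ a b : ℝ, a < b →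
        CorrectedTrapezoid.transplant n a b ψ ∈ CorrectedTrapezoid.monicPolys n) ∧
      IsLeast (CorrectedTrapezoid.admissibleConstants n p q ψ)
        (CorrectedTrapezoid.errorConst n p q ψ)) ∧
    -- the unique minimizer, the minimum value, and sharpness on every interval
    (∃! ψ : ℝ[X], CorrectedTrapezoid.IsMinimizer n p q ψ) ∧
    (∀ ψ : ℝ[X], CorrectedTrapezoid.IsMinimizer n p q ψ →
      CorrectedTrapezoid.errorConst n p q ψ =
        (2 : ℝ) ^ (-(n : ℝ) - (q⁻¹).toReal) *
          CorrectedTrapezoid.normOn (fun x => ψ.eval x) q (-1) 1 / (n.factorial : ℝ) ∧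
      ∀ a b : ℝ, a < b →
        IsLeast {c : ℝ | ∀ f : ℝ → ℝ, CorrectedTrapezoid.IsRegular n p a b f →
            |CorrectedTrapezoid.errorTerm n (CorrectedTrapezoid.transplant n a b ψ) f a b| ≤
              c * CorrectedTrapezoid.normOn (CorrectedTrapezoid.derivOn n f a b) p a b}
          (CorrectedTrapezoid.errorConst n p q ψ * (b - a) ^ ((n : ℝ) + (q⁻¹).toReal))) := by
  have hp0 : p ≠ 0 := ENNReal.HolderConjugate.ne_zero p q
  have hq1 : 1 ≤ q := ENNReal.HolderConjugate.one_le q p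
  refine ⟨fun a b hab f hf φ hφ => ⟨?_, ?_, ?_, ?_⟩, fun a b hab φ hφ => ⟨?_, ?_⟩,
    fun ψ hψ => ⟨fun a b hab => CorrectedTrapezoid.transplant_mem_monicPolys hab hψ, ?_⟩, ?_,
    fun ψ _ => ⟨CorrectedTrapezoid.errorConst_eq hn hp0 ψ, fun a b hab => ?_⟩⟩
  · exact hf.intervalIntegrable hab
  · exact CorrectedTrapezoid.intervalIntegrable_mul hpq hab.le hf.memLp
      (CorrectedTrapezoid.memLp_of_continuous φ.continuous q a b)
  · exact CorrectedTrapezoid.integral_eq_quadrature_add_errorTerm hab hf hφ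
  · exact CorrectedTrapezoid.abs_errorTerm_le hpq hab hf φ
  · obtain ⟨ψ, hψ, rfl⟩ := CorrectedTrapezoid.exists_transplant_eq hab hφ
    exact ⟨ψ, ⟨hψ, rfl⟩, fun χ hχ => CorrectedTrapezoid.transplant_injective n hab hχ.2.symm⟩
  · rintro ψ - rfl f hf
    have h := (CorrectedTrapezoid.isLeast_admissibleConstants hn hp0 (q := q) ψ).1
    rw [← CorrectedTrapezoid.errorConst_eq hn hp0] at h
    exact h a b hab f hf
  · rw [CorrectedTrapezoid.errorConst_eq hn hp0]
    exact CorrectedTrapezoid.isLeast_admissibleConstants hn hp0 ψ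
  · obtain ⟨ψ, hψ, hmin⟩ := CorrectedTrapezoid.exists_normOn_le n hq1
    refine ⟨ψ, (CorrectedTrapezoid.isMinimizer_iff hn hp0 ψ).2 ⟨hψ, hmin⟩, fun χ hχ => ?_⟩
    obtain ⟨hχm, hχmin⟩ := (CorrectedTrapezoid.isMinimizer_iff hn hp0 χ).1 hχ
    exact CorrectedTrapezoid.eq_of_normOn_le hq1 hχm hψ hχmin hmin
  · rw [CorrectedTrapezoid.errorConst_mul_rpow hn hp0 ψ hab]
    exact CorrectedTrapezoid.isLeast_errorTerm_bound hn hpq hab _
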